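/- Let $d\ge 1$, let $\Omega\subset\mathbb R^d$ be a bounded Lipschitz domain, let $p\ge 2$, let $g\in W^{1,p}(\Omega)^d$, and let $$W=\{u\in W^{1,p}(\Omega)^d : u|_{\partial\Omega}=g|_{\partial\Omega}\}$$ in the sense of traces. Let $\Lambda:\mathbb R\to\mathbb R$ be convex, strictly increasing and continuously differentiable, and assume that either $p>2$, or $p=2$ and $\Lambda$ is affine. Assume further that there are constants $a,b>0$ such that $$|\Lambda(t)|\le a+b\,t^{p/2}\qquad\text{for all } t\ge 0 .$$ (No separate growth condition on $\Lambda'$ is assumed.) Put $\alpha(t)=2\Lambda'(t)$. Denote by $\|\cdot\|$ the Frobenius norm and by $B:C=\sum_{i,j}B_{ij}C_{ij}$ the corresponding inner product of matrices, and let $W_0^{1,p}(\Omega)^d$ be the closure of $C_c^\infty(\Omega)^d$ in $W^{1,p}(\Omega)^d$. Then $$F(u)=\int_\Omega\Lambda(\|\nabla u\|^2)\,d\xi$$ is well defined on $W$ (the integrand is integrable), and $F:W\to\mathbb R$ is convex, continuous and Fréchet differentiable. More precisely, for every $u\in W$ we have $u+W_0^{1,p}(\Omega)^d\subset W$, the formula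 $$F'(u)h=\int_\Omega\alpha(\|\nabla u\|^2)\,(\nabla u:\nabla h)\,d\xi$$ (whose integrand is integrable) defines a bounded linear functional of $h\in W^{1,p}(\Omega)^d$, $$F(v)=F(u)+F'(u)(v-u)+o(\|v-u\|_{W^{1,p}})\qquad\text{as } v\to u,\ v\in W,$$ and the restriction of $F'(u)$ to $W_0^{1,p}(\Omega)^d$ is the Fréchet derivative of $h\mapsto F(u+h)$, $h\in W_0^{1,p}(\Omega)^d$, at $h=0$. -/

import Mathlib

open MeasureTheory Filter Topology
open scoped ENNReal NNReal ContDiff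

noncomputable section

/-- Euclidean space `ℝ^d`. -/
abbrev Euc (d : ℕ) : Type := EuclideanSpace ℝ (Fin d)

/-- Real `d × d` matrices with the Frobenius norm `‖B‖² = ∑ i j, B (i, j)²` and the inner product
`B : C = ∑ i j, B (i, j) * C (i, j)`. -/
abbrev Mat (d : ℕ) : Type := EuclideanSpace ℝ (Fin d × Fin d)

/-- Bounded Lipschitz domain: a bounded, open, connected, non-empty set which near each of its
boundary points lies strictly on one side of the graph of a Lipschitz function, in suitable
Cartesian coordinates. Here `e` is the direction of the last coordinate,
`y - ⟪e, y⟫ e` the part of `y` orthogonal to it, and `γ` the Lipschitz function. -/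
structure IsBoundedLipschitzDomain {d : ℕ} (Ω : Set (Euc d)) : Prop where
  isOpen : IsOpen Ω
  isConnected : IsConnected Ω
  isBounded : Bornology.IsBounded Ω
  local_graph : ∀ x ∈ frontier Ω, ∃ (e : Euc d) (γ : Euc d → ℝ) (K : ℝ≥0) (r : ℝ),
    ‖e‖ = 1 ∧ LipschitzWith K γ ∧ 0 < r ∧
      Ω ∩ Metric.ball x r =
        {y ∈ Metric.ball x r | γ (y - inner ℝ e y • e) < inner ℝ e y}

/-- `φ ∈ C_c^∞(Ω)`. -/
structure IsTestFunction {d : ℕ} {F : Type*} [NormedAddCommGroup F] [NormedSpace ℝ F]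
    (Ω : Set (Euc d)) (φ : Euc d → F) : Prop where
  smooth : ContDiff ℝ ∞ φ
  hasCompactSupport : HasCompactSupport φ
  tsupport_subset : tsupport φ ⊆ Ω

/-- The classical partial derivative `∂_j φ`. -/
def partialDeriv {d : ℕ} {F : Type*} [NormedAddCommGroup F] [NormedSpace ℝ F]
    (j : Fin d) (φ : Euc d → F) (x : Euc d) : F :=
  fderiv ℝ φ x (EuclideanSpace.single j 1)

/-- The classical gradient (Jacobian matrix), `(∇φ)_{ij} = ∂_j φ_i`. -/
def classicalGrad {d : ℕ} (φ : Euc d → Euc d) (x : Euc d) : Mat d :=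
  WithLp.toLp 2 fun ij => partialDeriv ij.2 φ x ij.1

/-- `G` is the weak gradient of `u` on `Ω`:
`∫_Ω u_i ∂_j ψ = - ∫_Ω G_{ij} ψ` for all `ψ ∈ C_c^∞(Ω)` and all `i`, `j`. -/
def IsWeakGrad {d : ℕ} (Ω : Set (Euc d)) (u : Euc d → Euc d) (G : Euc d → Mat d) : Prop :=
  ∀ ψ : Euc d → ℝ, IsTestFunction Ω ψ → ∀ i j : Fin d,
    ∫ x in Ω, u x i * partialDeriv j ψ x = - ∫ x in Ω, G x (i, j) * ψ x

section Linearity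

variable {d : ℕ} {Ω : Set (Euc d)}

theorem IsTestFunction.continuous_partialDeriv {F : Type*} [NormedAddCommGroup F]
    [NormedSpace ℝ F] {ψ : Euc d → F} (h : IsTestFunction Ω ψ) (j : Fin d) :
    Continuous (partialDeriv j ψ) :=
  (h.smooth.continuous_fderiv (by simp)).clm_apply continuous_const

theorem IsTestFunction.hasCompactSupport_partialDeriv {F : Type*} [NormedAddCommGroup F]
    [NormedSpace ℝ F] {ψ : Euc d → F} (h : IsTestFunction Ω ψ) (j : Fin d) :
    HasCompactSupport (partialDeriv j ψ) :=
  h.hasCompactSupport.fderiv_apply ℝ (EuclideanSpace.single j 1)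

theorem integrable_coord_mul {ι : Type*} [Fintype ι] {q : ℝ≥0∞} (hq : 1 ≤ q)
    (f : Lp (EuclideanSpace ℝ ι) q (volume.restrict Ω)) (k : ι) {ψ : Euc d → ℝ}
    (hψ : Continuous ψ) (hs : HasCompactSupport ψ) :
    Integrable (fun x => f x k * ψ x) (volume.restrict Ω) := by
  have h1 : LocallyIntegrable (fun x => f x k) (volume.restrict Ω) :=
    ((EuclideanSpace.proj (𝕜 := ℝ) k).comp_memLp' (Lp.memLp f)).locallyIntegrable hq
  have h2 := h1.integrable_smul_left_of_hasCompactSupport hψ hs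
  refine h2.congr (Filter.Eventually.of_forall fun x => ?_)
  simp [mul_comm]

end Linearity

/-- The vector fields `u : Ω → ℝ^d` in `L^q` with weak gradient in `L^q`, as the subspace of the
pairs `(u, ∇u)` in `L^q × L^q`. -/
def sobolevSubmodule {d : ℕ} (Ω : Set (Euc d)) (q : ℝ≥0∞) [Fact (1 ≤ q)] :
    Submodule ℝ (WithLp q
      (Lp (Euc d) q (volume.restrict Ω) × Lp (Mat d) q (volume.restrict Ω))) where
  carrier := {w | IsWeakGrad Ω w.fst w.snd}
  zero_mem' := by
    intro ψ _ i j
    rw [WithLp.zero_fst, WithLp.zero_snd]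
    have e1 : ∫ x in Ω, (0 : Lp (Euc d) q (volume.restrict Ω)) x i * partialDeriv j ψ x
        = ∫ _ in Ω, (0 : ℝ) := integral_congr_ae (by
      filter_upwards [Lp.coeFn_zero (Euc d) q (volume.restrict Ω)] with x hx
      rw [hx]; simp)
    have e2 : ∫ x in Ω, (0 : Lp (Mat d) q (volume.restrict Ω)) x (i, j) * ψ x
        = ∫ _ in Ω, (0 : ℝ) := integral_congr_ae (by
      filter_upwards [Lp.coeFn_zero (Mat d) q (volume.restrict Ω)] with x hx
      rw [hx]; simp)
    rw [e1, e2]; simp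
  add_mem' := by
    intro v w hv hw ψ hψ i j
    have hq : 1 ≤ q := Fact.out
    have c1 := hψ.continuous_partialDeriv j
    have c2 := hψ.hasCompactSupport_partialDeriv j
    have c3 := hψ.smooth.continuous
    have c4 := hψ.hasCompactSupport
    rw [WithLp.add_fst, WithLp.add_snd]
    have e1 : ∫ x in Ω, (v.fst + w.fst) x i * partialDeriv j ψ x
        = ∫ x in Ω, (v.fst x i * partialDeriv j ψ x + w.fst x i * partialDeriv j ψ x) :=
      integral_congr_ae (by
        filter_upwards [Lp.coeFn_add v.fst w.fst] with x hx
        rw [hx]; simp [add_mul])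
    have e2 : ∫ x in Ω, (v.snd + w.snd) x (i, j) * ψ x
        = ∫ x in Ω, (v.snd x (i, j) * ψ x + w.snd x (i, j) * ψ x) :=
      integral_congr_ae (by
        filter_upwards [Lp.coeFn_add v.snd w.snd] with x hx
        rw [hx]; simp [add_mul])
    rw [e1, e2,
      integral_add (integrable_coord_mul hq _ _ c1 c2) (integrable_coord_mul hq _ _ c1 c2),
      integral_add (integrable_coord_mul hq _ _ c3 c4) (integrable_coord_mul hq _ _ c3 c4),
      hv ψ hψ i j, hw ψ hψ i j]
    ring
  smul_mem' := by
    intro c w hw ψ hψ i j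
    rw [WithLp.smul_fst, WithLp.smul_snd]
    have e1 : ∫ x in Ω, (c • w.fst) x i * partialDeriv j ψ x
        = ∫ x in Ω, c * (w.fst x i * partialDeriv j ψ x) :=
      integral_congr_ae (by
        filter_upwards [Lp.coeFn_smul c w.fst] with x hx
        rw [hx]; simp [mul_assoc])
    have e2 : ∫ x in Ω, (c • w.snd) x (i, j) * ψ x = ∫ x in Ω, c * (w.snd x (i, j) * ψ x) :=
      integral_congr_ae (by
        filter_upwards [Lp.coeFn_smul c w.snd] with x hx
        rw [hx]; simp [mul_assoc])
    rw [e1, e2, integral_const_mul, integral_const_mul, hw ψ hψ i j]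
    ring

/-- The Sobolev space `W^{1,q}(Ω)^d`, with the norm `(‖u‖_{L^q}^q + ‖∇u‖_{L^q}^q)^{1/q}`
(for finite `q`). -/
abbrev SobolevSpace {d : ℕ} (Ω : Set (Euc d)) (q : ℝ≥0∞) [Fact (1 ≤ q)] : Type :=
  sobolevSubmodule Ω q

namespace SobolevSpace

variable {d : ℕ} {Ω : Set (Euc d)} {q : ℝ≥0∞} [Fact (1 ≤ q)]

/-- The underlying vector field of `u ∈ W^{1,q}(Ω)^d`. -/
def toLq (u : SobolevSpace Ω q) : Lp (Euc d) q (volume.restrict Ω) := u.1.fst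

/-- The weak gradient `∇u` of `u ∈ W^{1,q}(Ω)^d`. -/
def grad (u : SobolevSpace Ω q) : Lp (Mat d) q (volume.restrict Ω) := u.1.snd

end SobolevSpace

/-- The space `C_c^∞(Ω)^d` inside `W^{1,q}(Ω)^d`. -/
def testFunctionSubmodule {d : ℕ} (Ω : Set (Euc d)) (q : ℝ≥0∞) [Fact (1 ≤ q)] :
    Submodule ℝ (SobolevSpace Ω q) where
  carrier := {u | ∃ φ : Euc d → Euc d, IsTestFunction Ω φ ∧
    u.toLq =ᵐ[volume.restrict Ω] φ ∧ u.grad =ᵐ[volume.restrict Ω] classicalGrad φ}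
  zero_mem' := by
    refine ⟨0, ⟨contDiff_const, HasCompactSupport.zero, by simp [tsupport]⟩,
      Lp.coeFn_zero _ _ _, (Lp.coeFn_zero _ _ _).trans (Eventually.of_forall fun x => ?_)⟩
    ext ij
    simp [classicalGrad, partialDeriv]
  add_mem' := by
    rintro u v ⟨φ, hφ, hu, hu'⟩ ⟨χ, hχ, hv, hv'⟩
    refine ⟨φ + χ, ⟨hφ.smooth.add hχ.smooth, hφ.hasCompactSupport.add hχ.hasCompactSupport,
      (tsupport_add φ χ).trans (Set.union_subset hφ.tsupport_subset hχ.tsupport_subset)⟩, ?_, ?_⟩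
    · exact (Lp.coeFn_add u.toLq v.toLq).trans (hu.add hv)
    · refine (Lp.coeFn_add u.grad v.grad).trans ((hu'.add hv').trans
        (Eventually.of_forall fun x => ?_))
      have d1 := hφ.smooth.differentiable (by simp) x
      have d2 := hχ.smooth.differentiable (by simp) x
      ext ij
      simp [classicalGrad, partialDeriv, fderiv_add d1 d2]
  smul_mem' := by
    rintro c u ⟨φ, hφ, hu, hu'⟩
    refine ⟨c • φ, ⟨hφ.smooth.const_smul c, hφ.hasCompactSupport.smul_left (f := fun _ => c),
      (tsupport_smul_subset_right (fun _ => c) φ).trans hφ.tsupport_subset⟩, ?_, ?_⟩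
    · exact (Lp.coeFn_smul c u.toLq).trans (hu.const_smul c)
    · refine (Lp.coeFn_smul c u.grad).trans ((hu'.const_smul c).trans
        (Eventually.of_forall fun x => ?_))
      have d1 := hφ.smooth.differentiable (by simp) x
      ext ij
      simp [classicalGrad, partialDeriv, fderiv_const_smul d1]

/-- `W_0^{1,q}(Ω)^d`: the closure of `C_c^∞(Ω)^d` in `W^{1,q}(Ω)^d`. -/
def SobolevZero {d : ℕ} (Ω : Set (Euc d)) (q : ℝ≥0∞) [Fact (1 ≤ q)] :
    Submodule ℝ (SobolevSpace Ω q) :=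
  (testFunctionSubmodule Ω q).topologicalClosure

/-- The surface measure on `∂Ω` (the `(d-1)`-dimensional Hausdorff measure). -/
def surfaceMeasure {d : ℕ} (Ω : Set (Euc d)) : Measure (Euc d) :=
  (Measure.hausdorffMeasure ((d : ℝ) - 1)).restrict (frontier Ω)

/-- `τ ∈ L^q(∂Ω)^d` is the boundary trace `u|_{∂Ω}` of `u ∈ W^{1,q}(Ω)^d`: the trace operator is the
continuous extension of the restriction `φ ↦ φ|_{∂Ω}` of functions `φ` that are smooth up to the
boundary, so there are such `φ_n` with `φ_n → u` in `W^{1,q}(Ω)^d` and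
`φ_n|_{∂Ω} → τ` in `L^q(∂Ω)^d`. -/
def HasTrace {d : ℕ} {Ω : Set (Euc d)} {q : ℝ≥0∞} [Fact (1 ≤ q)] (u : SobolevSpace Ω q)
    (τ : Lp (Euc d) q (surfaceMeasure Ω)) : Prop :=
  ∃ φ : ℕ → Euc d → Euc d, (∀ n, ContDiff ℝ ∞ (φ n)) ∧
    Tendsto (fun n => eLpNorm (fun x => φ n x - u.toLq x) q (volume.restrict Ω)) atTop (𝓝 0) ∧
    Tendsto (fun n => eLpNorm (fun x => classicalGrad (φ n) x - u.grad x) q (volume.restrict Ω))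
      atTop (𝓝 0) ∧
    Tendsto (fun n => eLpNorm (fun x => φ n x - τ x) q (surfaceMeasure Ω)) atTop (𝓝 0)

/-- `W = {u ∈ W^{1,q}(Ω)^d : u|_{∂Ω} = g|_{∂Ω}}`. -/
def dirichletClass {d : ℕ} {Ω : Set (Euc d)} {q : ℝ≥0∞} [Fact (1 ≤ q)] (g : SobolevSpace Ω q) :
    Set (SobolevSpace Ω q) :=
  {u | ∃ τ : Lp (Euc d) q (surfaceMeasure Ω), HasTrace u τ ∧ HasTrace g τ}

/-- `F(u) = ∫_Ω Λ(‖∇u‖²) dξ`. -/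
def gradEnergy {d : ℕ} {Ω : Set (Euc d)} {q : ℝ≥0∞} [Fact (1 ≤ q)] (Λ : ℝ → ℝ)
    (u : SobolevSpace Ω q) : ℝ :=
  ∫ x in Ω, Λ (‖u.grad x‖ ^ 2)

end

/-! Everything happens on matrices. The integrand `A ↦ Λ(‖A‖²)` has gradient `φ(A) = 2Λ'(‖A‖²)A`,
and `φ(A)` is a subgradient at `A` because `Λ` is convex and increasing
(`inner_sqNormGradient_sub_le`). Convexity also converts the growth of `Λ` into growth of `Λ'`, so
that `‖φ(A)‖ ≤ C(1 + ‖A‖)^(p-1)` (`norm_sqNormGradient_le`). On a set of finite measure, `A ↦ φ ∘ A`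
is then continuous from `L^p` to `L^q`, with `q` conjugate to `p` (`continuous_nemytskii`).

Integrating the subgradient inequality gives `F'(u)(v-u) ≤ F(v) - F(u)`. Exchanging `u` and `v`
gives `0 ≤ F(v) - F(u) - F'(u)(v-u) ≤ (F'(v) - F'(u))(v-u)`, which is `o(‖v-u‖)` since `F'` is
continuous (`hasFDerivAt_of_subgradient`). This holds on all of `W^{1,p}`, after composition with
the continuous linear map `u ↦ ∇u`, and restricts to `W`. The class `W` enters only through its
convexity and its stability under `W_0`, which come from linearity of traces and from vanishing of
test functions on the boundary. -/

section Trace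

/-! ### Traces and the Dirichlet class. -/

/-- `L^q`-convergence of functions to elements of `L^q` is additive. -/
theorem tendsto_eLpNorm_sub_add {X E : Type*} [MeasurableSpace X] [NormedAddCommGroup E]
    {μ : Measure X} {q : ℝ≥0∞} (hq : 1 ≤ q) {f g : ℕ → X → E} (hf : ∀ n, AEStronglyMeasurable (f n) μ)
    (hg : ∀ n, AEStronglyMeasurable (g n) μ) (u v : Lp E q μ)
    (hfu : Tendsto (fun n => eLpNorm (fun x => f n x - u x) q μ) atTop (𝓝 0))
    (hgv : Tendsto (fun n => eLpNorm (fun x => g n x - v x) q μ) atTop (𝓝 0)) :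
    Tendsto (fun n => eLpNorm (fun x => (f n + g n) x - (u + v) x) q μ) atTop (𝓝 0) := by
  have hsum := hfu.add hgv
  rw [add_zero] at hsum
  refine tendsto_of_tendsto_of_tendsto_of_le_of_le tendsto_const_nhds hsum
    (fun _ => zero_le) fun n => ?_
  have hae : (fun x => (f n + g n) x - (u + v) x) =ᵐ[μ]
      (fun x => f n x - u x) + fun x => g n x - v x := by
    filter_upwards [Lp.coeFn_add u v] with x hx
    rw [hx]
    simp only [Pi.add_apply]
    abel
  change eLpNorm (fun x => (f n + g n) x - (u + v) x) q μ ≤ _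
  rw [eLpNorm_congr_ae hae]
  exact eLpNorm_add_le ((hf n).sub (Lp.aestronglyMeasurable u))
    ((hg n).sub (Lp.aestronglyMeasurable v)) hq

/-- `L^q`-convergence of functions to elements of `L^q` is homogeneous. -/
theorem tendsto_eLpNorm_sub_const_smul {X E : Type*} [MeasurableSpace X] [NormedAddCommGroup E]
    [NormedSpace ℝ E] {μ : Measure X} {q : ℝ≥0∞} {f : ℕ → X → E} (c : ℝ) (u : Lp E q μ)
    (hfu : Tendsto (fun n => eLpNorm (fun x => f n x - u x) q μ) atTop (𝓝 0)) :
    Tendsto (fun n => eLpNorm (fun x => (c • f n) x - (c • u) x) q μ) atTop (𝓝 0) := by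
  have hmul : Tendsto (fun n => ‖c‖ₑ * eLpNorm (fun x => f n x - u x) q μ) atTop (𝓝 0) := by
    simpa using ENNReal.Tendsto.const_mul hfu (Or.inr enorm_ne_top)
  refine hmul.congr fun n => ?_
  rw [← eLpNorm_const_smul]
  refine eLpNorm_congr_ae ?_
  filter_upwards [Lp.coeFn_smul c u] with x hx
  rw [hx]
  simp [smul_sub]

variable {d : ℕ} {Ω : Set (Euc d)} {q : ℝ≥0∞} [Fact (1 ≤ q)]

theorem classicalGrad_add {φ χ : Euc d → Euc d} (hφ : ContDiff ℝ ∞ φ) (hχ : ContDiff ℝ ∞ χ) :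
    classicalGrad (φ + χ) = classicalGrad φ + classicalGrad χ := by
  funext x
  have d1 := hφ.differentiable (by simp) x
  have d2 := hχ.differentiable (by simp) x
  ext ij
  simp [classicalGrad, partialDeriv, fderiv_add d1 d2]

theorem classicalGrad_const_smul {φ : Euc d → Euc d} (hφ : ContDiff ℝ ∞ φ) (c : ℝ) :
    classicalGrad (c • φ) = c • classicalGrad φ := by
  funext x
  have d1 := hφ.differentiable (by simp) x
  ext ij
  simp [classicalGrad, partialDeriv, fderiv_const_smul d1]

theorem continuous_classicalGrad {φ : Euc d → Euc d} (hφ : ContDiff ℝ ∞ φ) :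
    Continuous (classicalGrad φ) := by
  unfold classicalGrad partialDeriv
  have h := hφ.continuous_fderiv (by simp)
  fun_prop

theorem HasTrace.add {u v : SobolevSpace Ω q} {σ τ : Lp (Euc d) q (surfaceMeasure Ω)}
    (hu : HasTrace u σ) (hv : HasTrace v τ) : HasTrace (u + v) (σ + τ) := by
  have hq : 1 ≤ q := Fact.out
  obtain ⟨φ, hφ, h1, h2, h3⟩ := hu
  obtain ⟨χ, hχ, k1, k2, k3⟩ := hv
  refine ⟨fun n => φ n + χ n, fun n => (hφ n).add (hχ n), ?_, ?_, ?_⟩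
  · exact tendsto_eLpNorm_sub_add hq (fun n => (hφ n).continuous.aestronglyMeasurable)
      (fun n => (hχ n).continuous.aestronglyMeasurable) u.toLq v.toLq h1 k1
  · simp only [classicalGrad_add (hφ _) (hχ _)]
    exact tendsto_eLpNorm_sub_add hq
      (fun n => (continuous_classicalGrad (hφ n)).aestronglyMeasurable)
      (fun n => (continuous_classicalGrad (hχ n)).aestronglyMeasurable) u.grad v.grad h2 k2
  · exact tendsto_eLpNorm_sub_add hq (fun n => (hφ n).continuous.aestronglyMeasurable)
      (fun n => (hχ n).continuous.aestronglyMeasurable) σ τ h3 k3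

theorem HasTrace.const_smul {u : SobolevSpace Ω q} {σ : Lp (Euc d) q (surfaceMeasure Ω)}
    (hu : HasTrace u σ) (c : ℝ) : HasTrace (c • u) (c • σ) := by
  obtain ⟨φ, hφ, h1, h2, h3⟩ := hu
  refine ⟨fun n => c • φ n, fun n => (hφ n).const_smul c, ?_, ?_, ?_⟩
  · exact tendsto_eLpNorm_sub_const_smul c u.toLq h1
  · simp only [classicalGrad_const_smul (hφ _)]
    exact tendsto_eLpNorm_sub_const_smul c u.grad h2
  · exact tendsto_eLpNorm_sub_const_smul c σ h3

/-- Uniqueness of traces is not needed: even if `u` and `v` share different traces `σ`, `τ` with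
`g`, the combination `sσ + tτ` is a trace of `sg + tg = g`. -/
theorem convex_dirichletClass (g : SobolevSpace Ω q) : Convex ℝ (dirichletClass g) := by
  rintro u ⟨σ, hu, hgσ⟩ v ⟨τ, hv, hgτ⟩ s t - - hst
  refine ⟨s • σ + t • τ, (hu.const_smul s).add (hv.const_smul t), ?_⟩
  simpa [← add_smul, hst] using (hgσ.const_smul s).add (hgτ.const_smul t)

namespace SobolevSpace

/-- The inclusion of `W^{1,q}` in `L^q` as a continuous linear map. -/
noncomputable def toLqL (Ω : Set (Euc d)) (q : ℝ≥0∞) [Fact (1 ≤ q)] :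
    SobolevSpace Ω q →L[ℝ] Lp (Euc d) q (volume.restrict Ω) :=
  (WithLp.fstL q ℝ _ _).comp (sobolevSubmodule Ω q).subtypeL

/-- The weak gradient as a continuous linear map. -/
noncomputable def gradL (Ω : Set (Euc d)) (q : ℝ≥0∞) [Fact (1 ≤ q)] :
    SobolevSpace Ω q →L[ℝ] Lp (Mat d) q (volume.restrict Ω) :=
  (WithLp.sndL q ℝ _ _).comp (sobolevSubmodule Ω q).subtypeL

@[simp] theorem toLqL_apply (u : SobolevSpace Ω q) : toLqL Ω q u = u.toLq := rfl

@[simp] theorem gradL_apply (u : SobolevSpace Ω q) : gradL Ω q u = u.grad := rfl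

end SobolevSpace

/-- The approximating test functions serve as the sequence in `HasTrace`: their supports lie in the
open set `Ω`, which is disjoint from its frontier, so their boundary values are identically zero. -/
theorem hasTrace_zero_of_mem_sobolevZero (hΩ : IsOpen Ω) {h : SobolevSpace Ω q}
    (hh : h ∈ SobolevZero Ω q) : HasTrace h 0 := by
  have hcl : h ∈ closure (testFunctionSubmodule Ω q : Set (SobolevSpace Ω q)) := hh
  obtain ⟨w, hw, hlim⟩ := mem_closure_iff_seq_limit.1 hcl
  choose φ hφ hφ1 hφ2 using hw
  refine ⟨φ, fun n => (hφ n).smooth, ?_, ?_, ?_⟩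
  · have := (Lp.tendsto_Lp_iff_tendsto_eLpNorm' _ _).1
      (((SobolevSpace.toLqL Ω q).continuous.tendsto h).comp hlim)
    refine this.congr fun n => eLpNorm_congr_ae ?_
    filter_upwards [hφ1 n] with x hx
    simp [hx]
  · have := (Lp.tendsto_Lp_iff_tendsto_eLpNorm' _ _).1
      (((SobolevSpace.gradL Ω q).continuous.tendsto h).comp hlim)
    refine this.congr fun n => eLpNorm_congr_ae ?_
    filter_upwards [hφ2 n] with x hx
    simp [hx]
  · refine tendsto_const_nhds.congr fun n => Eq.symm ?_
    rw [← eLpNorm_zero (α := Euc d) (ε := Euc d) (p := q) (μ := surfaceMeasure Ω)]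
    refine eLpNorm_congr_ae ?_
    have hfr : ∀ᵐ x ∂surfaceMeasure Ω, x ∈ frontier Ω :=
      ae_restrict_mem isClosed_frontier.measurableSet
    filter_upwards [hfr, Lp.coeFn_zero (Euc d) q (surfaceMeasure Ω)] with x hx h0
    have hxΩ : x ∉ Ω := fun hmem => by
      rw [hΩ.frontier_eq] at hx
      exact hx.2 hmem
    rw [h0, image_eq_zero_of_notMem_tsupport fun hmem => hxΩ ((hφ n).tsupport_subset hmem)]
    simp

theorem add_mem_dirichletClass (hΩ : IsOpen Ω) {g u h : SobolevSpace Ω q}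
    (hu : u ∈ dirichletClass g) (hh : h ∈ SobolevZero Ω q) : u + h ∈ dirichletClass g := by
  obtain ⟨τ, hu, hg⟩ := hu
  exact ⟨τ, by simpa using hu.add (hasTrace_zero_of_mem_sobolevZero hΩ hh), hg⟩

end Trace

/-! ### Continuity of superposition operators from `L^p` to `L^q`. -/

section Nemytskii

variable {X E : Type*} [MeasurableSpace X] {μ : Measure X}

/-- Dominated convergence to zero, where the dominating functions vary by a sequence that tends
to zero in `L¹`. -/
theorem tendsto_lintegral_zero_of_le_add {f g : ℕ → X → ℝ≥0∞} {D : X → ℝ≥0∞}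
    (hf : ∀ n, AEMeasurable (f n) μ) (hg : ∀ n, AEMeasurable (g n) μ)
    (hD : ∫⁻ x, D x ∂μ ≠ ⊤) (hle : ∀ n x, f n x ≤ D x + g n x)
    (hg0 : Tendsto (fun n => ∫⁻ x, g n x ∂μ) atTop (𝓝 0))
    (hf0 : ∀ᵐ x ∂μ, Tendsto (fun n => f n x) atTop (𝓝 0)) :
    Tendsto (fun n => ∫⁻ x, f n x ∂μ) atTop (𝓝 0) := by
  -- The truncated difference `f n - g n` is dominated by the fixed `D`; then `f n ≤ (f n - g n) + g
  -- n`.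
  have h1 : Tendsto (fun n => ∫⁻ x, (f n x - g n x) ∂μ) atTop (𝓝 (∫⁻ _, 0 ∂μ)) := by
    refine tendsto_lintegral_of_dominated_convergence' D (fun n => (hf n).sub (hg n))
      (fun n => Eventually.of_forall fun x => tsub_le_iff_right.2 (hle n x)) hD ?_
    filter_upwards [hf0] with x hx
    exact tendsto_of_tendsto_of_tendsto_of_le_of_le tendsto_const_nhds hx
      (fun _ => zero_le) fun _ => tsub_le_self
  have h2 := h1.add hg0
  rw [lintegral_zero, add_zero] at h2
  refine tendsto_of_tendsto_of_tendsto_of_le_of_le tendsto_const_nhds h2 (fun _ => zero_le)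
    fun n => ?_
  change _ ≤ ∫⁻ x, (f n x - g n x) ∂μ + ∫⁻ x, g n x ∂μ
  rw [← lintegral_add_right' _ (hg n)]
  exact lintegral_mono fun x => le_tsub_add

variable [NormedAddCommGroup E] {p q : ℝ} {C : ℝ≥0} {φ : E → E}

theorem lintegral_enorm_rpow_ne_top (hp : 0 < p) {u : X → E}
    (hu : MemLp u (ENNReal.ofReal p) μ) : ∫⁻ x, ‖u x‖ₑ ^ p ∂μ ≠ ⊤ := by
  have hfin := (eLpNorm_lt_top_iff_lintegral_rpow_enorm_lt_top (ENNReal.ofReal_pos.2 hp).ne'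
    ENNReal.ofReal_ne_top).1 hu.eLpNorm_lt_top
  rw [ENNReal.toReal_ofReal hp.le] at hfin
  exact hfin.ne

theorem eLpNorm_ofReal_eq (hp : 0 < p) (u : X → E) :
    eLpNorm u (ENNReal.ofReal p) μ = (∫⁻ x, ‖u x‖ₑ ^ p ∂μ) ^ (1 / p) := by
  rw [eLpNorm_eq_lintegral_rpow_enorm_toReal (ENNReal.ofReal_pos.2 hp).ne'
    ENNReal.ofReal_ne_top, ENNReal.toReal_ofReal hp.le]

/-- Convergence in `L^p` in terms of `∫ |v_n - u|^p`. -/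
theorem tendsto_Lp_iff_tendsto_lintegral_rpow [Fact (1 ≤ ENNReal.ofReal p)] (hp : 0 < p)
    (v : ℕ → Lp E (ENNReal.ofReal p) μ) (u : Lp E (ENNReal.ofReal p) μ) :
    Tendsto v atTop (𝓝 u) ↔
      Tendsto (fun n => ∫⁻ x, ‖v n x - u x‖ₑ ^ p ∂μ) atTop (𝓝 0) := by
  rw [Lp.tendsto_Lp_iff_tendsto_eLpNorm']
  simp only [eLpNorm_ofReal_eq hp, Pi.sub_apply]
  constructor
  · intro h
    have := (ENNReal.continuous_rpow_const (y := p)).tendsto 0 |>.comp h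
    rw [ENNReal.zero_rpow_of_pos hp] at this
    refine this.congr fun n => ?_
    rw [Function.comp_apply, ← ENNReal.rpow_mul, one_div, inv_mul_cancel₀ hp.ne',
      ENNReal.rpow_one]
  · intro h
    have := (ENNReal.continuous_rpow_const (y := 1 / p)).tendsto 0 |>.comp h
    rwa [ENNReal.zero_rpow_of_pos (by positivity)] at this

theorem lintegral_one_add_enorm_rpow_ne_top [IsFiniteMeasure μ] (hp : 1 ≤ p) {u : X → E}
    (hu : MemLp u (ENNReal.ofReal p) μ) : ∫⁻ x, (1 + ‖u x‖ₑ) ^ p ∂μ ≠ ⊤ := by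
  refine ne_top_of_le_ne_top ?_
    (lintegral_mono fun x => ENNReal.rpow_add_le_mul_rpow_add_rpow 1 ‖u x‖ₑ hp)
  have h2 : (2 : ℝ≥0∞) ^ (p - 1) ≠ ⊤ :=
    ENNReal.rpow_ne_top_of_nonneg (by linarith) ENNReal.ofNat_ne_top
  rw [lintegral_const_mul' _ _ h2, lintegral_add_left measurable_const]
  refine ENNReal.mul_ne_top h2 (ENNReal.add_ne_top.2
    ⟨?_, lintegral_enorm_rpow_ne_top (by linarith) hu⟩)
  simp

/-- The exponents match because `(p - 1)q = p`. -/
theorem enorm_rpow_le_of_growth (hpq : p.HolderConjugate q)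
    (hC : ∀ A, ‖φ A‖ₑ ≤ C * (1 + ‖A‖ₑ) ^ (p - 1)) (A : E) :
    ‖φ A‖ₑ ^ q ≤ (C : ℝ≥0∞) ^ q * (1 + ‖A‖ₑ) ^ p := by
  refine (ENNReal.rpow_le_rpow (hC A) hpq.symm.nonneg).trans_eq ?_
  rw [ENNReal.mul_rpow_of_nonneg _ _ hpq.symm.nonneg, ← ENNReal.rpow_mul,
    hpq.sub_one_mul_conj]

theorem memLp_comp_of_growth [IsFiniteMeasure μ] (hpq : p.HolderConjugate q)
    (hφ : Continuous φ) (hC : ∀ A, ‖φ A‖ₑ ≤ C * (1 + ‖A‖ₑ) ^ (p - 1)) {u : X → E}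
    (hu : MemLp u (ENNReal.ofReal p) μ) :
    MemLp (fun x => φ (u x)) (ENNReal.ofReal q) μ := by
  refine ⟨hφ.comp_aestronglyMeasurable hu.1,
    (eLpNorm_lt_top_iff_lintegral_rpow_enorm_lt_top (ENNReal.ofReal_pos.2 hpq.symm.pos).ne'
      ENNReal.ofReal_ne_top).2 ?_⟩
  rw [ENNReal.toReal_ofReal hpq.symm.nonneg]
  refine (lintegral_mono fun x => enorm_rpow_le_of_growth hpq hC (u x)).trans_lt ?_
  have hCq : (C : ℝ≥0∞) ^ q ≠ ⊤ :=
    ENNReal.rpow_ne_top_of_nonneg hpq.symm.nonneg ENNReal.coe_ne_top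
  rw [lintegral_const_mul' _ _ hCq]
  exact (ENNReal.mul_ne_top hCq (lintegral_one_add_enorm_rpow_ne_top hpq.lt.le hu)).lt_top

/-- Domination for the continuity proof: with `A = u(x)` fixed and `B = v_n(x)`, the first term is a
fixed integrable function and the second tends to zero in `L¹`. -/
theorem enorm_sub_rpow_le_of_growth (hpq : p.HolderConjugate q)
    (hC : ∀ A, ‖φ A‖ₑ ≤ C * (1 + ‖A‖ₑ) ^ (p - 1)) (A B : E) :
    ‖φ B - φ A‖ₑ ^ q ≤ ((2 * C : ℝ≥0) : ℝ≥0∞) ^ q * 2 ^ (p - 1) * (1 + ‖A‖ₑ) ^ p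
      + ((2 * C : ℝ≥0) : ℝ≥0∞) ^ q * 2 ^ (p - 1) * ‖B - A‖ₑ ^ p := by
  have hp1 : 0 ≤ p - 1 := hpq.sub_one_pos.le
  set M : ℝ≥0∞ := (1 + ‖A‖ₑ) + ‖B - A‖ₑ with hM
  have hAM : 1 + ‖A‖ₑ ≤ M := le_self_add
  have hBM : 1 + ‖B‖ₑ ≤ M := by
    rw [hM, add_assoc]
    gcongr
    calc ‖B‖ₑ = ‖A + (B - A)‖ₑ := by congr 1; abel
      _ ≤ _ := enorm_add_le _ _
  have hle : ‖φ B - φ A‖ₑ ≤ ((2 * C : ℝ≥0) : ℝ≥0∞) * M ^ (p - 1) := by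
    calc ‖φ B - φ A‖ₑ ≤ ‖φ B‖ₑ + ‖φ A‖ₑ := enorm_sub_le
      _ ≤ C * M ^ (p - 1) + C * M ^ (p - 1) := by
        gcongr
        · exact (hC B).trans (by gcongr)
        · exact (hC A).trans (by gcongr)
      _ = _ := by push_cast; ring
  calc ‖φ B - φ A‖ₑ ^ q ≤ (((2 * C : ℝ≥0) : ℝ≥0∞) * M ^ (p - 1)) ^ q :=
        ENNReal.rpow_le_rpow hle hpq.symm.nonneg
    _ = ((2 * C : ℝ≥0) : ℝ≥0∞) ^ q * M ^ p := by
        rw [ENNReal.mul_rpow_of_nonneg _ _ hpq.symm.nonneg, ← ENNReal.rpow_mul,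
          hpq.sub_one_mul_conj]
    _ ≤ ((2 * C : ℝ≥0) : ℝ≥0∞) ^ q *
          (2 ^ (p - 1) * ((1 + ‖A‖ₑ) ^ p + ‖B - A‖ₑ ^ p)) := by
        gcongr
        exact ENNReal.rpow_add_le_mul_rpow_add_rpow _ _ hpq.lt.le
    _ = _ := by ring

/-- The superposition (Nemytskii) operator `u ↦ φ ∘ u` from `L^p` to `L^q`. -/
noncomputable def nemytskii [IsFiniteMeasure μ] (hpq : p.HolderConjugate q)
    (hφ : Continuous φ) (hC : ∀ A, ‖φ A‖ₑ ≤ C * (1 + ‖A‖ₑ) ^ (p - 1))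
    (u : Lp E (ENNReal.ofReal p) μ) : Lp E (ENNReal.ofReal q) μ :=
  (memLp_comp_of_growth hpq hφ hC (Lp.memLp u)).toLp _

theorem coeFn_nemytskii [IsFiniteMeasure μ] (hpq : p.HolderConjugate q)
    (hφ : Continuous φ) (hC : ∀ A, ‖φ A‖ₑ ≤ C * (1 + ‖A‖ₑ) ^ (p - 1))
    (u : Lp E (ENNReal.ofReal p) μ) :
    nemytskii hpq hφ hC u =ᵐ[μ] fun x => φ (u x) :=
  MemLp.coeFn_toLp _

theorem continuous_nemytskii [IsFiniteMeasure μ] [Fact (1 ≤ ENNReal.ofReal p)]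
    [Fact (1 ≤ ENNReal.ofReal q)] (hpq : p.HolderConjugate q) (hφ : Continuous φ)
    (hC : ∀ A, ‖φ A‖ₑ ≤ C * (1 + ‖A‖ₑ) ^ (p - 1)) :
    Continuous (nemytskii (μ := μ) hpq hφ hC) := by
  refine continuous_iff_seqContinuous.2 fun v u hv => ?_
  -- Convergence in `L^p` gives pointwise convergence only along subsequences, which suffices: every
  -- subsequence need only have a further one with the right limit.
  refine tendsto_of_subseq_tendsto fun ns hns => ?_
  obtain ⟨ms, hms, hae⟩ :=
    (tendstoInMeasure_of_tendsto_Lp (hv.comp hns)).exists_seq_tendsto_ae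
  have hsub : Tendsto (fun n => v (ns (ms n))) atTop (𝓝 u) :=
    (hv.comp hns).comp hms.tendsto_atTop
  refine ⟨ms, (tendsto_Lp_iff_tendsto_lintegral_rpow hpq.symm.pos _ _).2 ?_⟩
  have hK : ((2 * C : ℝ≥0) : ℝ≥0∞) ^ q * 2 ^ (p - 1) ≠ ⊤ :=
    ENNReal.mul_ne_top (ENNReal.rpow_ne_top_of_nonneg hpq.symm.nonneg ENNReal.coe_ne_top)
      (ENNReal.rpow_ne_top_of_nonneg hpq.sub_one_pos.le ENNReal.ofNat_ne_top)
  have hmeas : ∀ n, AEStronglyMeasurable (fun x => φ (v (ns (ms n)) x) - φ (u x)) μ := fun n =>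
    (hφ.comp_aestronglyMeasurable (Lp.aestronglyMeasurable _)).sub
      (hφ.comp_aestronglyMeasurable (Lp.aestronglyMeasurable _))
  have key : Tendsto (fun n => ∫⁻ x, ‖φ (v (ns (ms n)) x) - φ (u x)‖ₑ ^ q ∂μ) atTop (𝓝 0) := by
    refine tendsto_lintegral_zero_of_le_add
      (fun n => (hmeas n).enorm.pow_const q)
      (fun n => (((Lp.aestronglyMeasurable (v (ns (ms n)))).sub
        (Lp.aestronglyMeasurable u)).enorm.pow_const p).const_mul _)
      ?_ (fun n x => enorm_sub_rpow_le_of_growth hpq hC (u x) (v (ns (ms n)) x)) ?_ ?_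
    · rw [lintegral_const_mul' _ _ hK]
      exact ENNReal.mul_ne_top hK (lintegral_one_add_enorm_rpow_ne_top hpq.lt.le (Lp.memLp u))
    · have := ENNReal.Tendsto.const_mul
        ((tendsto_Lp_iff_tendsto_lintegral_rpow hpq.pos _ _).1 hsub) (Or.inr hK)
      rw [mul_zero] at this
      refine this.congr fun n => (lintegral_const_mul' _ _ hK).symm
    · filter_upwards [hae] with x hx
      have h1 : Tendsto (fun n => φ (v (ns (ms n)) x) - φ (u x)) atTop (𝓝 0) := by
        rw [← sub_self (φ (u x))]
        exact ((hφ.tendsto _).comp hx).sub_const _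
      have h2 := ((ENNReal.continuous_rpow_const (y := q)).tendsto _).comp
        ((continuous_enorm.tendsto _).comp h1)
      simpa [ENNReal.zero_rpow_of_pos hpq.symm.pos, Function.comp_def] using h2
  refine key.congr fun n => lintegral_congr_ae ?_
  filter_upwards [coeFn_nemytskii hpq hφ hC (v (ns (ms n))), coeFn_nemytskii hpq hφ hC u]
    with x h1 h2
  rw [Function.comp_apply, h1, h2]

end Nemytskii

/-! ### Differentiability from continuous subgradients. -/

section ConvexIntegral

/-- Average the subgradient inequalities based at the intermediate point `m`; their linear terms
cancel. -/
theorem convexOn_of_subgradient {V : Type*} [AddCommGroup V] [Module ℝ V] {S : Set V}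
    (hS : Convex ℝ S) {f : V → ℝ} (f' : V → V →ₗ[ℝ] ℝ)
    (h : ∀ u v, f' u (v - u) ≤ f v - f u) : ConvexOn ℝ S f := by
  refine ⟨hS, fun v _ w _ s t hs ht hst => ?_⟩
  set m := s • v + t • w with hm
  have h0 : s * f' m (v - m) + t * f' m (w - m) = 0 := by
    rw [← smul_eq_mul, ← smul_eq_mul, ← map_smul, ← map_smul, ← map_add, smul_sub, smul_sub,
      sub_add_sub_comm, ← add_smul, hst, one_smul, ← hm, sub_self, map_zero]
  have h1 := mul_le_mul_of_nonneg_left (h m v) hs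
  have h2 := mul_le_mul_of_nonneg_left (h m w) ht
  have h3 : s * f m + t * f m = f m := by rw [← add_mul, hst, one_mul]
  simp only [smul_eq_mul]
  linarith

/-- A functional with a continuous selection of subgradients is Fréchet differentiable. -/
theorem hasFDerivAt_of_subgradient {V F : Type*} [NormedAddCommGroup V] [NormedSpace ℝ V]
    [NormedAddCommGroup F] [NormedSpace ℝ F] {f : V → ℝ} (T : F →L[ℝ] V →L[ℝ] ℝ) {N : V → F}
    (hN : Continuous N) (h : ∀ u v, T (N u) (v - u) ≤ f v - f u) (u : V) :
    HasFDerivAt f (T (N u)) u := by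
  have hlim : Tendsto (fun v => ‖T‖ * ‖N v - N u‖) (𝓝 u) (𝓝 0) := by
    have hc := (((hN.sub (continuous_const (y := N u))).norm).const_mul ‖T‖).tendsto u
    simpa using hc
  refine HasFDerivAt.of_isLittleO (Asymptotics.isLittleO_iff.2 fun c hc => ?_)
  filter_upwards [hlim.eventually (gt_mem_nhds hc)] with v hv
  -- The two inequalities squeeze the remainder between `0` and `T (N v - N u) (v - u)`.
  have h1 := h u v
  have h2 := h v u
  have h3 : T (N v) (u - v) = -T (N v) (v - u) := by rw [← map_neg, neg_sub]
  have h4 : T (N v - N u) (v - u) = T (N v) (v - u) - T (N u) (v - u) := by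
    rw [map_sub T, _root_.sub_apply]
  have h5 := (le_abs_self _).trans (T.le_opNorm₂ (N v - N u) (v - u))
  have h6 := mul_le_mul_of_nonneg_right hv.le (norm_nonneg (v - u))
  rw [Real.norm_eq_abs, abs_of_nonneg (by linarith)]
  linarith

theorem HasFDerivAt.comp_const_add_coe {V : Type*} [NormedAddCommGroup V] [NormedSpace ℝ V]
    {f : V → ℝ} {f' : V →L[ℝ] ℝ} {u : V} (hf : HasFDerivAt f f' u) (S : Submodule ℝ V) :
    HasFDerivAt (fun h : S => f (u + (h : V))) (f'.comp S.subtypeL) 0 := by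
  have h0 : HasFDerivAt f f' (u + ((0 : S) : V)) := by simpa using hf
  exact h0.comp (0 : S) (S.subtypeL.hasFDerivAt.const_add u)

theorem integrable_inner_Lp {X E : Type*} [MeasurableSpace X] {μ : Measure X}
    [NormedAddCommGroup E] [InnerProductSpace ℝ E] {p q : ℝ}
    [(ENNReal.ofReal q).HolderConjugate (ENNReal.ofReal p)]
    (w : Lp E (ENNReal.ofReal q) μ) (h : Lp E (ENNReal.ofReal p) μ) :
    Integrable (fun x => inner ℝ (w x) (h x)) μ :=
  (L1.integrable_coeFn ((innerSL ℝ).holder 1 w h)).congr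
    ((innerSL ℝ).coeFn_holder (r := 1) w h)

variable {X E : Type*} [MeasurableSpace X] {μ : Measure X} [IsFiniteMeasure μ]
  [NormedAddCommGroup E] [InnerProductSpace ℝ E] {p q : ℝ}
  [(ENNReal.ofReal q).HolderConjugate (ENNReal.ofReal p)] {C : ℝ≥0} {φ : E → E} {f : E → ℝ}

theorem integrable_inner_of_growth (hpq : p.HolderConjugate q) (hφ : Continuous φ)
    (hC : ∀ A, ‖φ A‖ₑ ≤ C * (1 + ‖A‖ₑ) ^ (p - 1)) (u h : Lp E (ENNReal.ofReal p) μ) :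
    Integrable (fun x => inner ℝ (φ (u x)) (h x)) μ := by
  refine (integrable_inner_Lp (nemytskii hpq hφ hC u) h).congr ?_
  filter_upwards [coeFn_nemytskii hpq hφ hC u] with x hx
  rw [hx]

variable [Fact (1 ≤ ENNReal.ofReal p)] [Fact (1 ≤ ENNReal.ofReal q)]

/-- The functional `h ↦ ∫ ⟪φ(u), h⟫` on `L^p`. -/
noncomputable def integralGradient (hpq : p.HolderConjugate q) (hφ : Continuous φ)
    (hC : ∀ A, ‖φ A‖ₑ ≤ C * (1 + ‖A‖ₑ) ^ (p - 1)) (u : Lp E (ENNReal.ofReal p) μ) :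
    Lp E (ENNReal.ofReal p) μ →L[ℝ] ℝ :=
  (innerSL ℝ).lpPairing μ (ENNReal.ofReal q) (ENNReal.ofReal p) (nemytskii hpq hφ hC u)

theorem integralGradient_apply (hpq : p.HolderConjugate q) (hφ : Continuous φ)
    (hC : ∀ A, ‖φ A‖ₑ ≤ C * (1 + ‖A‖ₑ) ^ (p - 1)) (u h : Lp E (ENNReal.ofReal p) μ) :
    integralGradient hpq hφ hC u h = ∫ x, inner ℝ (φ (u x)) (h x) ∂μ := by
  rw [integralGradient, ContinuousLinearMap.lpPairing_eq_integral]
  refine integral_congr_ae ?_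
  filter_upwards [coeFn_nemytskii hpq hφ hC u] with x hx
  rw [hx, innerSL_apply_apply]

theorem integralGradient_sub_le (hpq : p.HolderConjugate q) (hφ : Continuous φ)
    (hC : ∀ A, ‖φ A‖ₑ ≤ C * (1 + ‖A‖ₑ) ^ (p - 1))
    (hint : ∀ u : Lp E (ENNReal.ofReal p) μ, Integrable (fun x => f (u x)) μ)
    (hsub : ∀ A B, inner ℝ (φ A) (B - A) ≤ f B - f A) (u v : Lp E (ENNReal.ofReal p) μ) :
    integralGradient hpq hφ hC u (v - u) ≤ ∫ x, f (v x) ∂μ - ∫ x, f (u x) ∂μ := by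
  rw [integralGradient_apply, ← integral_sub (hint v) (hint u)]
  refine integral_mono_ae (integrable_inner_of_growth hpq hφ hC u (v - u))
    ((hint v).sub (hint u)) ?_
  filter_upwards [Lp.coeFn_sub v u] with x hx
  rw [hx]
  exact hsub _ _

/-- An integral functional on `L^p` whose integrand `f` is convex with gradient `φ` of growth
`p - 1` is Fréchet differentiable. -/
theorem hasFDerivAt_integral_of_subgradient (hpq : p.HolderConjugate q) (hφ : Continuous φ)
    (hC : ∀ A, ‖φ A‖ₑ ≤ C * (1 + ‖A‖ₑ) ^ (p - 1))
    (hint : ∀ u : Lp E (ENNReal.ofReal p) μ, Integrable (fun x => f (u x)) μ)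
    (hsub : ∀ A B, inner ℝ (φ A) (B - A) ≤ f B - f A) (u : Lp E (ENNReal.ofReal p) μ) :
    HasFDerivAt (fun v : Lp E (ENNReal.ofReal p) μ => ∫ x, f (v x) ∂μ)
      (integralGradient hpq hφ hC u) u :=
  hasFDerivAt_of_subgradient
    ((innerSL ℝ).lpPairing μ (ENNReal.ofReal q) (ENNReal.ofReal p))
    (continuous_nemytskii hpq hφ hC) (integralGradient_sub_le hpq hφ hC hint hsub) u

end ConvexIntegral

/-! ### The integrand `Λ(‖A‖²)`: convexity and growth. -/

section Energy

theorem ConvexOn.deriv_mul_sub_le {Λ : ℝ → ℝ} (hconv : ConvexOn ℝ Set.univ Λ)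
    (hd : Differentiable ℝ Λ) (t s : ℝ) : deriv Λ t * (s - t) ≤ Λ s - Λ t := by
  rcases lt_trichotomy t s with h | rfl | h
  · have := hconv.deriv_le_slope (Set.mem_univ _) (Set.mem_univ _) h (hd t)
    rwa [slope_def_field, le_div_iff₀ (sub_pos.2 h)] at this
  · simp
  · have := hconv.slope_le_deriv (Set.mem_univ _) (Set.mem_univ _) h (hd t)
    rw [slope_def_field, div_le_iff₀ (sub_pos.2 h)] at this
    linarith

variable {Λ : ℝ → ℝ} {p a b : ℝ}

/-- The derivative of a convex function inherits a polynomial growth bound. -/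
theorem deriv_mul_one_add_le_of_growth (hconv : ConvexOn ℝ Set.univ Λ)
    (hd : Differentiable ℝ Λ) {r : ℝ} (hr : 0 ≤ r) (ha : 0 ≤ a) (hb : 0 ≤ b)
    (hgrowth : ∀ t : ℝ, 0 ≤ t → |Λ t| ≤ a + b * t ^ r) {t : ℝ} (ht : 0 ≤ t) :
    deriv Λ t * (1 + t) ≤ (2 * a + b * 2 ^ r + b) * (1 + t) ^ r := by
  -- The increment from `t` to `2t + 1` is `1 + t`, not `t`, so the bound stays useful near `t = 0`;
  -- and `2t + 1 ≤ 2(1 + t)` produces the factor `2 ^ r`.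
  have h1 := hconv.deriv_mul_sub_le hd t (2 * t + 1)
  have h2 := (le_abs_self _).trans (hgrowth (2 * t + 1) (by linarith))
  have h3 := (neg_abs_le _).trans' (neg_le_neg (hgrowth t ht))
  have h4 : (2 * t + 1) ^ r ≤ 2 ^ r * (1 + t) ^ r := by
    rw [← Real.mul_rpow (by norm_num) (by linarith)]
    exact Real.rpow_le_rpow (by linarith) (by linarith) hr
  have h5 : t ^ r ≤ (1 + t) ^ r := Real.rpow_le_rpow ht (by linarith) hr
  have h6 : 1 ≤ (1 + t) ^ r := Real.one_le_rpow (by linarith) hr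
  have h7 := mul_le_mul_of_nonneg_left h4 hb
  have h8 := mul_le_mul_of_nonneg_left h5 hb
  have h9 := mul_le_mul_of_nonneg_left h6 ha
  have h10 : deriv Λ t * (2 * t + 1 - t) = deriv Λ t * (1 + t) := by ring
  linarith

theorem sq_rpow_half {x : ℝ} (hx : 0 ≤ x) (p : ℝ) : (x ^ 2) ^ (p / 2) = x ^ p := by
  rw [← Real.rpow_natCast, ← Real.rpow_mul hx]
  congr 1
  push_cast
  ring

theorem integrable_sqNorm_of_growth {X E : Type*} [MeasurableSpace X]
    [NormedAddCommGroup E] {μ : Measure X}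
    [IsFiniteMeasure μ] (hΛ : Continuous Λ) (hp : 0 < p)
    (hgrowth : ∀ t : ℝ, 0 ≤ t → |Λ t| ≤ a + b * t ^ (p / 2))
    (u : Lp E (ENNReal.ofReal p) μ) : Integrable (fun x => Λ (‖u x‖ ^ 2)) μ := by
  have h1 : Integrable (fun x => ‖u x‖ ^ p) μ := by
    have := (Lp.memLp u).integrable_norm_rpow (ENNReal.ofReal_pos.2 hp).ne'
      ENNReal.ofReal_ne_top
    rwa [ENNReal.toReal_ofReal hp.le] at this
  refine ((integrable_const a).add (h1.const_mul b)).mono'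
    (hΛ.comp_aestronglyMeasurable ((Lp.aestronglyMeasurable u).norm.pow 2)) ?_
  refine Eventually.of_forall fun x => ?_
  have := hgrowth (‖u x‖ ^ 2) (sq_nonneg _)
  rwa [sq_rpow_half (norm_nonneg _)] at this

variable {E : Type*} [NormedAddCommGroup E] [InnerProductSpace ℝ E]

/-- The gradient of `A ↦ Λ(‖A‖²)`. -/
noncomputable def sqNormGradient (Λ : ℝ → ℝ) (A : E) : E := (2 * deriv Λ (‖A‖ ^ 2)) • A

theorem continuous_sqNormGradient (hC1 : ContDiff ℝ 1 Λ) :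
    Continuous (sqNormGradient Λ : E → E) := by
  have h := hC1.continuous_deriv le_rfl
  unfold sqNormGradient
  fun_prop

/-- The tangent inequality for `Λ` at `‖A‖²`, with `‖B‖² - ‖A‖²` expanded around `A`; the quadratic
term `Λ'(‖A‖²)‖B - A‖²` is dropped because `Λ' ≥ 0`. -/
theorem inner_sqNormGradient_sub_le (hconv : ConvexOn ℝ Set.univ Λ) (hmono : Monotone Λ)
    (hd : Differentiable ℝ Λ) (A B : E) :
    inner ℝ (sqNormGradient Λ A) (B - A) ≤ Λ (‖B‖ ^ 2) - Λ (‖A‖ ^ 2) := by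
  have h1 := hconv.deriv_mul_sub_le hd (‖A‖ ^ 2) (‖B‖ ^ 2)
  have h2 : 0 ≤ deriv Λ (‖A‖ ^ 2) := hmono.deriv_nonneg
  have h3 : ‖B‖ ^ 2 = ‖A‖ ^ 2 + 2 * inner ℝ A (B - A) + ‖B - A‖ ^ 2 := by
    rw [← norm_add_sq_real, add_sub_cancel]
  rw [sqNormGradient, real_inner_smul_left]
  have h4 := mul_nonneg h2 (sq_nonneg ‖B - A‖)
  have h5 : deriv Λ (‖A‖ ^ 2) * (‖B‖ ^ 2 - ‖A‖ ^ 2)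
      = 2 * deriv Λ (‖A‖ ^ 2) * inner ℝ A (B - A) + deriv Λ (‖A‖ ^ 2) * ‖B - A‖ ^ 2 := by
    rw [h3]; ring
  linarith

theorem norm_sqNormGradient_le (hconv : ConvexOn ℝ Set.univ Λ) (hmono : Monotone Λ)
    (hd : Differentiable ℝ Λ) (hp : 0 ≤ p) (ha : 0 ≤ a) (hb : 0 ≤ b)
    (hgrowth : ∀ t : ℝ, 0 ≤ t → |Λ t| ≤ a + b * t ^ (p / 2)) (A : E) :
    ‖sqNormGradient Λ A‖ ≤ 4 * (2 * a + b * 2 ^ (p / 2) + b) * (1 + ‖A‖) ^ (p - 1) := by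
  have hx : 0 ≤ ‖A‖ := norm_nonneg A
  have h0 : 0 ≤ deriv Λ (‖A‖ ^ 2) := hmono.deriv_nonneg
  have h1 := deriv_mul_one_add_le_of_growth hconv hd (by positivity) ha hb hgrowth
    (sq_nonneg ‖A‖)
  have h2 : (1 + ‖A‖ ^ 2) ^ (p / 2) ≤ (1 + ‖A‖) ^ p := by
    rw [← sq_rpow_half (by positivity) p]
    exact Real.rpow_le_rpow (by positivity) (by nlinarith) (by positivity)
  have hK : 0 ≤ 2 * a + b * 2 ^ (p / 2) + b := by positivity
  have h3 := h1.trans (mul_le_mul_of_nonneg_left h2 hK)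
  have hpos : 0 < 1 + ‖A‖ := by linarith
  rw [Real.rpow_sub_one hpos.ne', ← mul_div_assoc, le_div_iff₀ hpos, sqNormGradient, norm_smul,
    Real.norm_of_nonneg (by positivity)]
  -- The factor 4 is the 2 in the gradient times the 2 in `‖A‖(1 + ‖A‖) ≤ 2(1 + ‖A‖²)`.
  nlinarith [mul_nonneg h0 (sq_nonneg (‖A‖ - 1)), mul_nonneg h0 (sq_nonneg ‖A‖)]

theorem enorm_sqNormGradient_le (hconv : ConvexOn ℝ Set.univ Λ) (hmono : Monotone Λ)
    (hd : Differentiable ℝ Λ) (hp : 1 ≤ p) (ha : 0 ≤ a) (hb : 0 ≤ b)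
    (hgrowth : ∀ t : ℝ, 0 ≤ t → |Λ t| ≤ a + b * t ^ (p / 2)) (A : E) :
    ‖sqNormGradient Λ A‖ₑ ≤
      (Real.toNNReal (4 * (2 * a + b * 2 ^ (p / 2) + b)) : ℝ≥0) * (1 + ‖A‖ₑ) ^ (p - 1) := by
  have h := norm_sqNormGradient_le hconv hmono hd (by linarith) ha hb hgrowth A
  rw [← ofReal_norm, ← ofReal_norm]
  refine (ENNReal.ofReal_le_ofReal h).trans_eq ?_
  rw [ENNReal.ofReal_mul (by positivity),
    ← ENNReal.ofReal_rpow_of_nonneg (by positivity) (by linarith),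
    ENNReal.ofReal_add zero_le_one (norm_nonneg A), ENNReal.ofReal_one]
  rfl

end Energy

theorem lemma2p2 (d : ℕ) (hd : 1 ≤ d) (Ω : Set (Euc d)) (hΩ : IsBoundedLipschitzDomain Ω)
    (p : ℝ) [Fact (1 ≤ ENNReal.ofReal p)]
    (g : SobolevSpace Ω (ENNReal.ofReal p))
    (Λ : ℝ → ℝ) (hconv : ConvexOn ℝ Set.univ Λ) (hmono : StrictMono Λ) (hC1 : ContDiff ℝ 1 Λ)
    (hp : 2 < p ∨ (p = 2 ∧ ∃ m k : ℝ, ∀ t, Λ t = m * t + k))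
    (a b : ℝ) (ha : 0 < a) (hb : 0 < b)
    (hgrowth : ∀ t : ℝ, 0 ≤ t → |Λ t| ≤ a + b * t ^ (p / 2))
    (α : ℝ → ℝ) (hα : ∀ t, α t = 2 * deriv Λ t) :
    -- `F` is well defined on `W`
    (∀ u ∈ dirichletClass g, IntegrableOn (fun x => Λ (‖u.grad x‖ ^ 2)) Ω) ∧
    -- `F` is convex and continuous on `W`
    ConvexOn ℝ (dirichletClass g) (gradEnergy Λ) ∧
    ContinuousOn (gradEnergy Λ) (dirichletClass g) ∧
    -- `F` is Fréchet differentiable on `W`, where `u + W_0 ⊆ W`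
    ∀ u ∈ dirichletClass g,
      (∀ h ∈ SobolevZero Ω (ENNReal.ofReal p), u + h ∈ dirichletClass g) ∧
      ∃ F' : SobolevSpace Ω (ENNReal.ofReal p) →L[ℝ] ℝ,
        (∀ h, IntegrableOn (fun x => α (‖u.grad x‖ ^ 2) * inner ℝ (u.grad x) (h.grad x)) Ω ∧
          F' h = ∫ x in Ω, α (‖u.grad x‖ ^ 2) * inner ℝ (u.grad x) (h.grad x)) ∧
        HasFDerivWithinAt (gradEnergy Λ) F' (dirichletClass g) u ∧
        HasFDerivAt (fun h : SobolevZero Ω (ENNReal.ofReal p) => gradEnergy Λ (u + (h : SobolevSpace Ω (ENNReal.ofReal p))))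
          (F'.comp (SobolevZero Ω (ENNReal.ofReal p)).subtypeL) 0 := by
  have hp2 : 2 ≤ p := hp.elim le_of_lt fun h => h.1.ge
  have hpq : p.HolderConjugate (p.conjExponent) :=
    Real.HolderConjugate.conjExponent (by linarith)
  set q := p.conjExponent with hq
  have : Fact (1 ≤ ENNReal.ofReal q) := ⟨by simpa using hpq.symm.lt.le⟩
  have : (ENNReal.ofReal q).HolderConjugate (ENNReal.ofReal p) := hpq.symm.ennrealOfReal
  have : IsFiniteMeasure (volume.restrict Ω) :=
    ⟨by simpa using hΩ.isBounded.measure_lt_top⟩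
  have hd' : Differentiable ℝ Λ := hC1.differentiable (by simp)
  have hφ := continuous_sqNormGradient (E := Mat d) hC1
  have hC := enorm_sqNormGradient_le (E := Mat d) hconv hmono.monotone hd' (by linarith) ha.le
    hb.le hgrowth
  have hint := integrable_sqNorm_of_growth (E := Mat d) (μ := volume.restrict Ω) hC1.continuous
    (by linarith) hgrowth
  have hsub := inner_sqNormGradient_sub_le (E := Mat d) hconv hmono.monotone hd'
  let F' : SobolevSpace Ω (ENNReal.ofReal p) → SobolevSpace Ω (ENNReal.ofReal p) →L[ℝ] ℝ :=
    fun u => (integralGradient hpq hφ hC u.grad).comp (SobolevSpace.gradL Ω (ENNReal.ofReal p))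
  -- By definition the energy is the integral functional on `L^p` composed with `gradL`, so the
  -- chain rule applies at every point of `W^{1,p}`.
  have hderiv : ∀ u, HasFDerivAt (gradEnergy Λ) (F' u) u := fun u =>
    (hasFDerivAt_integral_of_subgradient hpq hφ hC hint hsub u.grad).comp u
      (SobolevSpace.gradL Ω (ENNReal.ofReal p)).hasFDerivAt
  refine ⟨fun u _ => hint u.grad, ?_, fun u _ => (hderiv u).continuousAt.continuousWithinAt,
    fun u hu => ⟨fun h hh => add_mem_dirichletClass hΩ.isOpen hu hh, F' u, fun h => ?_,
      (hderiv u).hasFDerivWithinAt, ?_⟩⟩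
  · exact convexOn_of_subgradient (convex_dirichletClass g) (fun u => (F' u).toLinearMap)
      fun u v => integralGradient_sub_le hpq hφ hC hint hsub u.grad v.grad
  · have heq : ∀ x, inner ℝ (sqNormGradient Λ (u.grad x)) (h.grad x)
        = α (‖u.grad x‖ ^ 2) * inner ℝ (u.grad x) (h.grad x) := fun x => by
      rw [sqNormGradient, real_inner_smul_left, hα]
    exact ⟨(integrable_inner_of_growth hpq hφ hC u.grad h.grad).congr (Eventually.of_forall heq),
      (integralGradient_apply hpq hφ hC u.grad h.grad).trans
        (integral_congr_ae (Eventually.of_forall heq))⟩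
  · exact (hderiv u).comp_const_add_coe (SobolevZero Ω (ENNReal.ofReal p))
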